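/- Let $k$ be an algebraically closed field of characteristic zero; a variety is an algebraic variety over $k$ (a reduced separated scheme of finite type over $k$), its points are its closed points, and $\mathrm{Aut}(X)$ is the group of automorphisms of $X$ over $k$. A group $H$ is called Jordan if there is a positive integer $d$ such that every finite subgroup $K$ of $H$ contains a normal abelian subgroup whose index in $K$ is at most $d$; the least such $d$ is denoted by $J_H$. Let $X$ be an irreducible variety and, for a point $x\in X$, let $\mathrm{T}_{x,X}$ be the tangent space of $X$ at $x$. Then the maximum $$m=\max_{x\in X}\dim_k \mathrm{T}_{x,X}$$ exists, and the following hold. (1) If $G$ is a finite subgroup of $\mathrm{Aut}(X)$ that has a fixed point in $X$ (a point $x$ with $g\cdot x=x$ for all $g\in G$), then $G$ has a normal abelian subgroup whose index in $G$ is at most $J_{\mathbf{GL}_m(k)}$. (2) If every finite subgroup of $\mathrm{Aut}(X)$ has a fixed point in $X$, then $\mathrm{Aut}(X)$ is Jordan and $J_{\mathrm{Aut}(X)}\leqslant J_{\mathbf{GL}_m(k)}$. -/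

import Mathlib

open CategoryTheory AlgebraicGeometry

universe u v

/-- `G` satisfies the Jordan condition with bound `d`: every finite subgroup `K` of `G` contains
a normal abelian subgroup whose index in `K` is at most `d`. -/
def JordanBound (G : Type v) [Group G] (d : ℕ) : Prop :=
  ∀ K : Subgroup G, Finite K →
    ∃ A : Subgroup K, A.Normal ∧ IsMulCommutative A ∧ A.index ≤ d

/-- A group is Jordan if the Jordan condition holds with some positive integer bound. -/
def IsJordanGroup (G : Type v) [Group G] : Prop :=
  ∃ d : ℕ, 0 < d ∧ JordanBound G d

/-- The Jordan constant of `G`: the minimal positive integer `d` for which the Jordan condition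
holds (and the value `0`, smaller than every admissible bound, if `G` is not Jordan). -/
noncomputable def jordanConstant (G : Type v) [Group G] : ℕ :=
  sInf {d : ℕ | 0 < d ∧ JordanBound G d}

/-- An algebraic variety over the field `k`, given by its structure morphism `π : X ⟶ Spec k`:
a reduced separated scheme of finite type over `k`. It need not be irreducible. -/
structure IsAlgebraicVariety {k : Type u} [Field k] {X : Scheme.{u}}
    (π : X ⟶ Spec (.of k)) : Prop where
  isReduced : AlgebraicGeometry.IsReduced X
  isSeparated : IsSeparated π
  locallyOfFiniteType : LocallyOfFiniteType π
  quasiCompact : QuasiCompact π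

/-- The group of automorphisms of `X` over `k`. -/
abbrev VarietyAut {k : Type u} [Field k] {X : Scheme.{u}} (π : X ⟶ Spec (.of k)) : Type u :=
  Aut (Over.mk π)

/-- The action of an automorphism over `k` on the underlying set of the scheme. -/
noncomputable def VarietyAut.act {k : Type u} [Field k] {X : Scheme.{u}}
    {π : X ⟶ Spec (.of k)} (g : VarietyAut π) (x : X) : X :=
  g.hom.left x

/-- The points of the variety in the classical sense: the closed points of the scheme. -/
abbrev VarietyPoint (X : Scheme.{u}) : Type u := closedPoints X

/-- The set of automorphisms `G` has a common fixed point among the points of the variety. -/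
def HasFixedPoint {k : Type u} [Field k] {X : Scheme.{u}} {π : X ⟶ Spec (.of k)}
    (G : Subgroup (VarietyAut π)) : Prop :=
  ∃ x : VarietyPoint X, ∀ g ∈ G, VarietyAut.act g x.1 = x.1

/-- The (Zariski) tangent space of `X` at `x`: the dual of `𝔪 / 𝔪 ^ 2` over the residue field,
where `𝔪` is the maximal ideal of the local ring of `X` at `x`. -/
abbrev ZariskiTangentSpace (X : Scheme.{u}) (x : X) : Type u :=
  Module.Dual (IsLocalRing.ResidueField (X.presheaf.stalk x))
    (IsLocalRing.CotangentSpace (X.presheaf.stalk x))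

/-- The dimension of the tangent space of `X` at `x`. -/
noncomputable def tangentDim (X : Scheme.{u}) (x : X) : ℕ :=
  Module.finrank (IsLocalRing.ResidueField (X.presheaf.stalk x)) (ZariskiTangentSpace X x)

/-- The maximal dimension of a tangent space at a point of the variety. -/
noncomputable def maxTangentDim (X : Scheme.{u}) : ℕ :=
  ⨆ x : VarietyPoint X, tangentDim X x.1

/-!
A finite group `G` of automorphisms fixing a closed point `x` acts on the local ring `𝒪` at `x`.
The action is faithful: `X` is reduced and irreducible, so `Spec 𝒪` is dense in it, and a morphism
to a separated scheme is determined by its restriction to a dense part. The induced action on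
`𝔪 / 𝔪 ^ 2` is still faithful in characteristic zero: if `σ ^ N = 1` with `N` invertible, then for
every `j` there is an endomorphism `w` with `σ - 1 = (σ - 1) ^ j * w`; if moreover `σ` is trivial
modulo `𝔪 ^ 2`, then `(σ - 1) ^ j` maps `𝒪` into `𝔪 ^ j`, and `σ = 1` by Krull's intersection
theorem. So `G` embeds into `GL_m(k)`.

Since `jordanConstant` is `0` for a group that is not Jordan, the theorem contains the classical
theorem of Jordan for `GL_m(k)`. The entries of the matrices in a finite group generate a
countable field, which embeds into `ℂ`, and averaging gives an invariant norm. If `g` and `h` lie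
within `1/2` of `1`, then `⁅g, h⁆` is closer to `1` than `h`, so by induction it commutes with
`g`; the powers `⁅g, h⁆ ^ n = ⁅g ^ n, h⁆` then all stay within `1` of `1`, which forces
`⁅g, h⁆ = 1`. Hence the elements near `1` generate an abelian subgroup, which is normal, and a
packing bound in the unit ball of matrices bounds its index.

The maximum `m` exists because `X` is covered by finitely many affine open sets, and at a closed
point `dim 𝔪 / 𝔪 ^ 2` is at most the number of generators `aᵢ` of the coordinate ring: the
differences `aᵢ - aᵢ(x)` generate `𝔪`.
-/

section JordanGroups

/-- `G` has a normal abelian subgroup of index at most `d`, the property that `JordanBound`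
requires of finite subgroups. It is meant for finite `G`: an infinite index counts as `0`. -/
def HasNormalAbelianSubgroupOfIndexLE (G : Type*) [Group G] (d : ℕ) : Prop :=
  ∃ A : Subgroup G, A.Normal ∧ IsMulCommutative A ∧ A.index ≤ d

variable {G H : Type*} [Group G] [Group H] {d : ℕ}

theorem HasNormalAbelianSubgroupOfIndexLE.of_injective [Finite H]
    (h : HasNormalAbelianSubgroupOfIndexLE H d) {f : G →* H} (hf : Function.Injective f) :
    HasNormalAbelianSubgroupOfIndexLE G d := by
  obtain ⟨A, hA, hcomm, hindex⟩ := h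
  refine ⟨A.comap f, hA.comap f, ⟨⟨fun x y => ?_⟩⟩, ?_⟩
  · have hxy : f x * f y = f y * f x :=
      congrArg Subtype.val (hcomm.is_comm.comm (⟨f x, x.2⟩ : A) ⟨f y, y.2⟩)
    exact Subtype.ext (hf (by simpa only [Subgroup.coe_mul, map_mul] using hxy))
  · rw [Subgroup.index_comap]
    exact (Nat.le_of_dvd (Nat.pos_of_ne_zero A.index_ne_zero_of_finite)
      (Subgroup.relIndex_dvd_index_of_normal A f.range)).trans hindex

theorem JordanBound.hasNormalAbelianSubgroup_of_injective [Finite G] (hH : JordanBound H d)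
    {f : G →* H} (hf : Function.Injective f) : HasNormalAbelianSubgroupOfIndexLE G d :=
  have : Finite f.range := Finite.of_surjective _ f.rangeRestrict_surjective
  have hrange : HasNormalAbelianSubgroupOfIndexLE f.range d := hH f.range this
  hrange.of_injective (f := f.rangeRestrict) (f.rangeRestrict_injective_iff.2 hf)

theorem IsJordanGroup.jordanBound_jordanConstant (h : IsJordanGroup G) :
    JordanBound G (jordanConstant G) :=
  (Nat.sInf_mem h).2

theorem IsJordanGroup.jordanConstant_pos (h : IsJordanGroup G) : 0 < jordanConstant G :=
  (Nat.sInf_mem h).1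

theorem JordanBound.jordanConstant_le (hd : 0 < d) (h : JordanBound G d) : jordanConstant G ≤ d :=
  Nat.sInf_le ⟨hd, h⟩

end JordanGroups

section NormBoundedRepresentations

open scoped commutatorElement

theorem commutatorElement_pow_left_of_commute {G : Type*} [Group G] {g h : G}
    (hcomm : Commute g ⁅g, h⁆) (n : ℕ) : ⁅g ^ n, h⁆ = ⁅g, h⁆ ^ n := by
  induction n with
  | zero => simp
  | succ n ih =>
    calc ⁅g ^ (n + 1), h⁆ = g * ⁅g ^ n, h⁆ * g⁻¹ * ⁅g, h⁆ := by
          simp only [commutatorElement_def]; group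
      _ = ⁅g, h⁆ ^ n * ⁅g, h⁆ := by rw [ih, (hcomm.pow_right n).mul_inv_cancel]
      _ = ⁅g, h⁆ ^ (n + 1) := (pow_succ _ n).symm

theorem eq_one_of_pow_eq_one_of_norm_pow_sub_one_lt {A : Type*} [NormedRing A] [NormedAlgebra ℝ A]
    {a : A} {N : ℕ} (hN : N ≠ 0) (ha : a ^ N = 1) (hlt : ∀ n, ‖a ^ n - 1‖ < 1) : a = 1 := by
  by_contra hne
  have hpos : 0 < ‖a - 1‖ := norm_pos_iff.2 (sub_ne_zero.2 hne)
  have hdist : ‖∑ n ∈ Finset.range N, (a ^ n - 1)‖ < N :=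
    calc ‖∑ n ∈ Finset.range N, (a ^ n - 1)‖ ≤ ∑ n ∈ Finset.range N, ‖a ^ n - 1‖ :=
          norm_sum_le _ _
      _ < ∑ _n ∈ Finset.range N, (1 : ℝ) :=
          Finset.sum_lt_sum_of_nonempty (Finset.nonempty_range_iff.2 hN) fun n _ => hlt n
      _ = N := by simp
  have hprod : (a - 1) * ∑ n ∈ Finset.range N, (a ^ n - 1) = -((N : ℝ) • (a - 1)) := by
    rw [Finset.sum_sub_distrib, mul_sub, mul_geom_sum, ha, sub_self, zero_sub,
      Finset.sum_const, Finset.card_range, nsmul_one, ← (Nat.cast_commute N _).eq, ← nsmul_eq_mul,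
      Nat.cast_smul_eq_nsmul]
  have hle : N * ‖a - 1‖ ≤ ‖a - 1‖ * ‖∑ n ∈ Finset.range N, (a ^ n - 1)‖ := by
    simpa only [hprod, norm_neg, norm_smul, Real.norm_natCast] using
      norm_mul_le (a - 1) (∑ n ∈ Finset.range N, (a ^ n - 1))
  nlinarith

theorem natCard_le_of_norm_le_one_of_pairwise_half_le_norm_sub {E ι : Type*}
    [NormedAddCommGroup E] [NormedSpace ℝ E] [FiniteDimensional ℝ E] [Finite ι] {f : ι → E}
    (hf : ∀ i, ‖f i‖ ≤ 1) (hsep : Pairwise fun i j => 1 / 2 ≤ ‖f i - f j‖) :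
    Nat.card ι ≤ 5 ^ Module.finrank ℝ E := by
  classical
  have := Fintype.ofFinite ι
  have hsep₂ (i j : ι) (hij : i ≠ j) : 1 ≤ ‖(2 : ℝ) • f i - (2 : ℝ) • f j‖ := by
    have hle : 1 / 2 ≤ ‖f i - f j‖ := hsep hij
    rw [← smul_sub, norm_smul, Real.norm_ofNat]
    linarith
  have hinj : Function.Injective fun i => (2 : ℝ) • f i := fun i j hij => by
    by_contra hne
    have hle := hsep₂ i j hne
    rw [show (2 : ℝ) • f i = (2 : ℝ) • f j from hij, sub_self, norm_zero] at hle
    exact absurd hle (by norm_num)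
  rw [Nat.card_eq_fintype_card, ← Finset.card_univ, ← Finset.card_image_of_injective _ hinj]
  refine Besicovitch.card_le_of_separated _ ?_ ?_
  · simp only [Finset.forall_mem_image, norm_smul, Real.norm_ofNat]
    intro i _
    linarith [hf i]
  · simp only [Finset.forall_mem_image]
    exact fun i _ j _ hij => hsep₂ i j fun h => hij (h ▸ rfl)

variable {A G : Type*} [NormedRing A] [Group G] {ρ : G →* A}

theorem norm_map_mul_le (hρ : ∀ g, ‖ρ g‖ ≤ 1) (g : G) (a : A) : ‖ρ g * a‖ ≤ ‖a‖ :=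
  (norm_mul_le _ _).trans (mul_le_of_le_one_left (norm_nonneg _) (hρ g))

theorem norm_mul_map_le (hρ : ∀ g, ‖ρ g‖ ≤ 1) (g : G) (a : A) : ‖a * ρ g‖ ≤ ‖a‖ :=
  (norm_mul_le _ _).trans (mul_le_of_le_one_right (norm_nonneg _) (hρ g))

theorem norm_map_inv_mul_sub_one_le (hρ : ∀ g, ‖ρ g‖ ≤ 1) (g h : G) :
    ‖ρ (g⁻¹ * h) - 1‖ ≤ ‖ρ h - ρ g‖ := by
  have hfactor : ρ (g⁻¹ * h) - 1 = ρ g⁻¹ * (ρ h - ρ g) := by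
    rw [mul_sub, ← map_mul, ← map_mul, inv_mul_cancel, map_one]
  exact hfactor ▸ norm_map_mul_le hρ _ _

theorem norm_map_conj_sub_one_le (hρ : ∀ g, ‖ρ g‖ ≤ 1) (g h : G) :
    ‖ρ (g * h * g⁻¹) - 1‖ ≤ ‖ρ h - 1‖ := by
  have hfactor : ρ (g * h * g⁻¹) - 1 = ρ g * ((ρ h - 1) * ρ g⁻¹) := by
    rw [sub_mul, mul_sub, one_mul, ← map_mul, ← map_mul, ← map_mul, mul_inv_cancel, map_one,
      mul_assoc]
  rw [hfactor]
  exact (norm_map_mul_le hρ _ _).trans (norm_mul_map_le hρ _ _)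

theorem norm_map_commutator_sub_one_le_two_mul (hρ : ∀ g, ‖ρ g‖ ≤ 1) (g h : G) :
    ‖ρ ⁅g, h⁆ - 1‖ ≤ 2 * ‖ρ h - 1‖ := by
  have hfactor : ρ ⁅g, h⁆ - 1 = ((ρ (g * h * g⁻¹) - 1) - (ρ h - 1)) * ρ h⁻¹ := by
    rw [sub_sub_sub_cancel_right, sub_mul, ← map_mul, ← map_mul, mul_inv_cancel, map_one,
      commutatorElement_def]
  rw [hfactor, two_mul]
  exact (norm_mul_map_le hρ _ _).trans <| (norm_sub_le _ _).trans <| by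
    gcongr
    exact norm_map_conj_sub_one_le hρ g h

theorem norm_map_commutator_sub_one_le (hρ : ∀ g, ‖ρ g‖ ≤ 1) (g h : G) :
    ‖ρ ⁅g, h⁆ - 1‖ ≤ 2 * ‖ρ g - 1‖ * ‖ρ h - 1‖ := by
  have hfactor : ρ ⁅g, h⁆ - 1 =
      ((ρ g - 1) * (ρ h - 1) - (ρ h - 1) * (ρ g - 1)) * ρ (h * g)⁻¹ := by
    have hbracket : (ρ g - 1) * (ρ h - 1) - (ρ h - 1) * (ρ g - 1) = ρ (g * h) - ρ (h * g) := by
      rw [map_mul, map_mul]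
      noncomm_ring
    rw [hbracket, sub_mul, ← map_mul, ← map_mul, mul_inv_cancel, map_one, commutatorElement_def,
      mul_inv_rev, mul_assoc (g * h)]
  calc ‖ρ ⁅g, h⁆ - 1‖
      ≤ ‖(ρ g - 1) * (ρ h - 1) - (ρ h - 1) * (ρ g - 1)‖ := hfactor ▸ norm_mul_map_le hρ _ _
    _ ≤ ‖ρ g - 1‖ * ‖ρ h - 1‖ + ‖ρ h - 1‖ * ‖ρ g - 1‖ :=
        (norm_sub_le _ _).trans (add_le_add (norm_mul_le _ _) (norm_mul_le _ _))
    _ = 2 * ‖ρ g - 1‖ * ‖ρ h - 1‖ := by ring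

/-- The group elements that `ρ` maps to within distance `1 / 2` of `1`. With this radius, the
commutator of two of them is closer to `1` than either. -/
def nearIdentity (ρ : G →* A) : Set G := {g | ‖ρ g - 1‖ < 1 / 2}

theorem conj_mem_nearIdentity (hρ : ∀ g, ‖ρ g‖ ≤ 1) (g : G) {h : G} (hh : h ∈ nearIdentity ρ) :
    g * h * g⁻¹ ∈ nearIdentity ρ :=
  (norm_map_conj_sub_one_le hρ g h).trans_lt hh

theorem normal_closure_nearIdentity (hρ : ∀ g, ‖ρ g‖ ≤ 1) :
    (Subgroup.closure (nearIdentity ρ)).Normal := by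
  have hconj : Group.conjugatesOfSet (nearIdentity ρ) ⊆ nearIdentity ρ := fun x hx => by
    obtain ⟨h, hh, hconj⟩ := Group.mem_conjugatesOfSet_iff.1 hx
    obtain ⟨g, rfl⟩ := isConj_iff.1 hconj
    exact conj_mem_nearIdentity hρ g hh
  rw [← hconj.antisymm Group.subset_conjugatesOfSet]
  exact Subgroup.normalClosure_normal

variable [NormedAlgebra ℝ A]

theorem commutator_eq_one_of_mem_nearIdentity_of_commute [Finite G] (hinj : Function.Injective ρ)
    (hρ : ∀ g, ‖ρ g‖ ≤ 1) {g h : G} (hh : h ∈ nearIdentity ρ) (hcomm : Commute g ⁅g, h⁆) :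
    ⁅g, h⁆ = 1 := by
  apply hinj
  rw [map_one]
  refine eq_one_of_pow_eq_one_of_norm_pow_sub_one_lt (orderOf_pos ⁅g, h⁆).ne' ?_ fun n => ?_
  · rw [← map_pow, pow_orderOf_eq_one, map_one]
  · rw [← map_pow, ← commutatorElement_pow_left_of_commute hcomm]
    have hlt : ‖ρ h - 1‖ < 1 / 2 := hh
    linarith [norm_map_commutator_sub_one_le_two_mul hρ (g ^ n) h]

theorem commute_of_mem_nearIdentity [Finite G] (hinj : Function.Injective ρ)
    (hρ : ∀ g, ‖ρ g‖ ≤ 1) {g h : G} (hg : g ∈ nearIdentity ρ) (hh : h ∈ nearIdentity ρ) :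
    Commute g h := by
  have wf : WellFounded fun a b : G => ‖ρ a - 1‖ < ‖ρ b - 1‖ :=
    @Finite.wellFounded_of_trans_of_irrefl G _ _ ⟨fun _ _ _ => lt_trans⟩ ⟨fun _ => lt_irrefl _⟩
  induction h using wf.induction with
  | _ h ih =>
    obtain rfl | hne := eq_or_ne h 1
    · exact Commute.one_right g
    have hpos : 0 < ‖ρ h - 1‖ := norm_sub_pos_iff.2 (map_one ρ ▸ hinj.ne hne)
    have hcloser : ‖ρ ⁅g, h⁆ - 1‖ < ‖ρ h - 1‖ := by
      have hlt : ‖ρ g - 1‖ < 1 / 2 := hg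
      nlinarith [norm_map_commutator_sub_one_le hρ g h]
    exact commutatorElement_eq_one_iff_commute.1 <|
      commutator_eq_one_of_mem_nearIdentity_of_commute hinj hρ hh
        (ih _ hcloser (hcloser.trans hh))

variable [FiniteDimensional ℝ A]

theorem index_le_of_nearIdentity_subset (hρ : ∀ g, ‖ρ g‖ ≤ 1) {H : Subgroup G} [H.FiniteIndex]
    (hH : nearIdentity ρ ⊆ H) : H.index ≤ 5 ^ Module.finrank ℝ A := by
  refine natCard_le_of_norm_le_one_of_pairwise_half_le_norm_sub
    (f := fun q : G ⧸ H => ρ q.out) (fun q => hρ q.out) fun q r hqr => ?_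
  contrapose! hqr with hlt
  have hmem : q.out⁻¹ * r.out ∈ H :=
    hH ((norm_map_inv_mul_sub_one_le hρ _ _).trans_lt (norm_sub_rev (ρ q.out) _ ▸ hlt))
  simpa only [QuotientGroup.out_eq'] using QuotientGroup.eq.2 hmem

theorem hasNormalAbelianSubgroup_of_norm_map_le_one [Finite G] (hinj : Function.Injective ρ)
    (hρ : ∀ g, ‖ρ g‖ ≤ 1) : HasNormalAbelianSubgroupOfIndexLE G (5 ^ Module.finrank ℝ A) :=
  ⟨Subgroup.closure (nearIdentity ρ), normal_closure_nearIdentity hρ,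
    Subgroup.isMulCommutative_closure fun _ hg _ hh => commute_of_mem_nearIdentity hinj hρ hg hh,
    index_le_of_nearIdentity_subset hρ Subgroup.subset_closure⟩

end NormBoundedRepresentations

section LinearGroups

theorem exists_invariant_norm {V G : Type*} [AddCommGroup V] [Module ℝ V] [FiniteDimensional ℝ V]
    [Group G] [Finite G] (ρ : G →* Module.End ℝ V) :
    ∃ p : Seminorm ℝ V, (∀ v, p v = 0 → v = 0) ∧ ∀ g v, p (ρ g v) = p v := by
  have := Fintype.ofFinite G
  let e := (Module.finBasis ℝ V).equivFun
  let p : Seminorm ℝ V := ∑ g, (normSeminorm ℝ _).comp (e.toLinearMap ∘ₗ ρ g)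
  have hp (v : V) : p v = ∑ g, ‖e (ρ g v)‖ := by
    change FunLike.coeAddMonoidHom _ _ _ p v = _
    simp only [p, map_sum, Finset.sum_apply]
    rfl
  refine ⟨p, fun v hv => ?_, fun g v => ?_⟩
  · rw [hp, Finset.sum_eq_zero_iff_of_nonneg fun _ _ => norm_nonneg _] at hv
    simpa using hv 1 (Finset.mem_univ 1)
  · rw [hp, hp]
    exact Fintype.sum_equiv (Equiv.mulRight g) _ _ fun h => by
      rw [Equiv.coe_mulRight, map_mul, Module.End.mul_apply]

theorem hasNormalAbelianSubgroup_of_injective_real {V G : Type*} [AddCommGroup V] [Module ℝ V]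
    [FiniteDimensional ℝ V] [Group G] [Finite G] {ρ : G →* Module.End ℝ V}
    (hρ : Function.Injective ρ) :
    HasNormalAbelianSubgroupOfIndexLE G (5 ^ (Module.finrank ℝ V * Module.finrank ℝ V)) := by
  obtain ⟨p, hp, hinv⟩ := exists_invariant_norm ρ
  let _ : Norm V := ⟨p⟩
  have core : NormedSpace.Core ℝ V :=
    { norm_nonneg := apply_nonneg p
      norm_smul := map_smul_eq_mul p
      norm_triangle := map_add_le_add p
      norm_eq_zero_iff := fun v => ⟨hp v, fun h => h ▸ map_zero p⟩ }
  let _ : NormedAddCommGroup V := NormedAddCommGroup.ofCore core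
  let _ : NormedSpace ℝ V := NormedSpace.ofCore core
  let E : Module.End ℝ V ≃ₐ[ℝ] (V →L[ℝ] V) := Module.End.toContinuousLinearMap V
  let σ : G →* (V →L[ℝ] V) := (E : Module.End ℝ V →* (V →L[ℝ] V)).comp ρ
  have hσ (g : G) : ‖σ g‖ ≤ 1 := ContinuousLinearMap.opNorm_le_bound _ zero_le_one fun v =>
    (hinv g v).trans_le (one_mul ‖v‖).ge
  have hbound := hasNormalAbelianSubgroup_of_norm_map_le_one (ρ := σ) (E.injective.comp hρ) hσ
  rwa [← E.toLinearEquiv.finrank_eq, Module.finrank_linearMap] at hbound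

theorem hasNormalAbelianSubgroup_of_injective_complex {ι G : Type*} [Fintype ι] [DecidableEq ι]
    [Group G] [Finite G] {ρ : G →* Matrix ι ι ℂ} (hρ : Function.Injective ρ) :
    HasNormalAbelianSubgroupOfIndexLE G
      (5 ^ ((2 * Fintype.card ι) * (2 * Fintype.card ι))) := by
  let τ : Matrix ι ι ℂ →* Module.End ℝ (ι → ℂ) :=
    { toFun := fun M => (Matrix.toLin' M).restrictScalars ℝ
      map_one' := by rw [Matrix.toLin'_one]; rfl
      map_mul' := fun M N => by rw [Matrix.toLin'_mul]; rfl }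
  have hτ : Function.Injective τ :=
    (LinearMap.restrictScalars_injective ℝ).comp Matrix.toLin'.injective
  have hfinrank : Module.finrank ℝ (ι → ℂ) = 2 * Fintype.card ι := by
    rw [Module.finrank_pi_fintype]
    simp [mul_comm]
  have hbound := hasNormalAbelianSubgroup_of_injective_real (ρ := τ.comp ρ) (hτ.comp hρ)
  rwa [hfinrank] at hbound

open Cardinal in
theorem nonempty_algHom_of_lift_trdeg_le {R : Type*} {K : Type v} {L : Type u} [CommRing R]
    [Nontrivial R] [Field K] [Algebra R K] [FaithfulSMul R K] [Field L] [IsAlgClosed L]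
    [Algebra R L] [FaithfulSMul R L]
    (h : lift.{u} (Algebra.trdeg R K) ≤ lift.{v} (Algebra.trdeg R L)) :
    Nonempty (K →ₐ[R] L) := by
  obtain ⟨s, hs⟩ := exists_isTranscendenceBasis R K
  obtain ⟨t, ht⟩ := exists_isTranscendenceBasis R L
  rw [← hs.cardinalMk_eq_trdeg, ← ht.cardinalMk_eq_trdeg, lift_mk_le'] at h
  obtain ⟨f⟩ := h
  have hf : AlgebraicIndependent R fun i => (f i : L) := ht.1.comp f f.injective
  let S := Algebra.adjoin R (Set.range ((↑) : s → K))
  let φ : S →ₐ[R] L := (MvPolynomial.aeval fun i => (f i : L)).comp hs.1.repr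
  have hφ : Function.Injective φ :=
    (show Function.Injective (MvPolynomial.aeval _) from hf).comp hs.1.aevalEquiv.symm.injective
  let _ : Algebra S L := φ.toAlgebra
  have : IsScalarTower R S L := .of_algebraMap_eq' φ.comp_algebraMap.symm
  have : FaithfulSMul S L := (faithfulSMul_iff_algebraMap_injective S L).2 hφ
  have : Algebra.IsAlgebraic S K := hs.isAlgebraic
  exact ⟨(IsAlgClosed.lift : K →ₐ[S] L).restrictScalars R⟩

open Cardinal in
theorem nonempty_ringHom_complex (K : Type*) [Field K] [CharZero K] [Countable K] :
    Nonempty (K →+* ℂ) := by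
  have htrdeg : Algebra.trdeg ℚ ℂ = 𝔠 := by
    obtain ⟨s, hs⟩ := exists_isTranscendenceBasis ℚ ℂ
    rw [← hs.cardinalMk_eq_trdeg, ← mk_complex]
    exact (IsAlgClosed.cardinal_eq_cardinal_transcendence_basis_of_aleph0_lt' _ hs mk_le_aleph0
      (mk_complex ▸ aleph0_lt_continuum)).symm
  have hle : lift (Algebra.trdeg ℚ K) ≤ lift (Algebra.trdeg ℚ ℂ) := by
    obtain ⟨s, hs⟩ := exists_isTranscendenceBasis ℚ K
    rw [htrdeg, lift_continuum, lift_id'.{0}, ← hs.cardinalMk_eq_trdeg]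
    exact (mk_le_aleph0 (α := s)).trans aleph0_le_continuum
  exact (nonempty_algHom_of_lift_trdeg_le hle).map fun f => f.toRingHom

theorem exists_injective_matrix_complex {M ι k : Type*} [Monoid M] [Countable M] [Fintype ι]
    [DecidableEq ι] [Field k] [CharZero k] {ρ : M →* Matrix ι ι k} (hρ : Function.Injective ρ) :
    ∃ σ : M →* Matrix ι ι ℂ, Function.Injective σ := by
  let entries : Set k := Set.range fun p : M × ι × ι => ρ p.1 p.2.1 p.2.2
  let K := Subfield.closure entries
  have : Countable K := by
    rw [← Cardinal.mk_le_aleph0_iff]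
    exact (Subfield.cardinalMk_closure_le_max entries).trans
      (max_le (Cardinal.mk_le_aleph0_iff.2 (Set.countable_range _).to_subtype) le_rfl)
  obtain ⟨φ⟩ := nonempty_ringHom_complex K
  let ρK (m : M) : Matrix ι ι K :=
    .of fun i j => ⟨ρ m i j, Subfield.subset_closure ⟨(m, i, j), rfl⟩⟩
  have hρK (m : M) : K.subtype.mapMatrix (ρK m) = ρ m := rfl
  have hinj : Function.Injective (K.subtype.mapMatrix : Matrix ι ι K →+* Matrix ι ι k) :=
    Matrix.map_injective K.subtype.injective
  let ρK' : M →* Matrix ι ι K :=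
    { toFun := ρK
      map_one' := hinj (by rw [hρK, map_one, map_one])
      map_mul' := fun m n => hinj (by simp only [hρK, map_mul]) }
  refine ⟨(φ.mapMatrix : Matrix ι ι K →+* Matrix ι ι ℂ).toMonoidHom.comp ρK', ?_⟩
  exact (Matrix.map_injective φ.injective).comp fun m n h => hρ <| by
    rw [← hρK, ← hρK, show ρK m = ρK n from h]

theorem jordanBound_generalLinearGroup (ι k : Type*) [Fintype ι] [DecidableEq ι] [Field k]
    [CharZero k] : JordanBound (GL ι k) (5 ^ ((2 * Fintype.card ι) * (2 * Fintype.card ι))) := by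
  intro G hG
  obtain ⟨σ, hσ⟩ := exists_injective_matrix_complex (ρ := (Units.coeHom _).comp G.subtype)
    (Units.val_injective.comp G.subtype_injective)
  exact hasNormalAbelianSubgroup_of_injective_complex hσ

theorem isJordanGroup_generalLinearGroup (ι k : Type*) [Fintype ι] [DecidableEq ι] [Field k]
    [CharZero k] : IsJordanGroup (GL ι k) :=
  ⟨_, by positivity, jordanBound_generalLinearGroup ι k⟩

end LinearGroups

section FiniteOrder

theorem sub_one_pow_dvd_of_pow_eq_one {E : Type*} [Ring E] {x : E} {N : ℕ} (hN : IsUnit (N : E))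
    (hx : x ^ N = 1) (j : ℕ) : (x - 1) ^ j ∣ x - 1 := by
  have hsq : (x - 1) * (x - 1) ∣ x - 1 := by
    have hsum : x - 1 ∣ ∑ i ∈ Finset.range N, x ^ i - N := by
      rw [show (∑ i ∈ Finset.range N, x ^ i - N : E) = ∑ i ∈ Finset.range N, (x ^ i - 1) by simp]
      exact Finset.dvd_sum fun i _ => ⟨_, (mul_geom_sum x i).symm⟩
    have hmul : (x - 1) * (∑ i ∈ Finset.range N, x ^ i - N) = -((x - 1) * N) := by
      rw [mul_sub, mul_geom_sum, hx, sub_self, zero_sub]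
    rw [← hN.dvd_mul_right, ← dvd_neg, ← hmul]
    exact mul_dvd_mul_left _ hsum
  induction j with
  | zero =>
    rw [pow_zero]
    exact one_dvd _
  | succ j ih =>
    rw [pow_succ']
    exact (mul_dvd_mul_left _ ih).trans hsq

theorem map_sub_mem_pow_succ {R : Type*} [CommRing R] {I : Ideal R} {σ : R →+* R}
    (hσ : ∀ a, σ a - a ∈ I ^ 2) {j : ℕ} {a : R} (ha : a ∈ I ^ j) : σ a - a ∈ I ^ (j + 1) := by
  induction j generalizing a with
  | zero => exact Ideal.pow_le_pow_right one_le_two (hσ a)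
  | succ j ih =>
    rw [pow_succ] at ha
    refine Submodule.mul_induction_on ha (fun x hx y hy => ?_) fun x y hx hy => ?_
    · have hy' : σ y ∈ I := sub_add_cancel (σ y) y ▸
        add_mem (Ideal.pow_le_self two_ne_zero (hσ y)) hy
      have hleibniz : σ (x * y) - x * y = (σ x - x) * σ y + x * (σ y - y) := by
        rw [map_mul]
        ring
      rw [hleibniz]
      exact add_mem (pow_succ I (j + 1) ▸ Ideal.mul_mem_mul (ih hx) hy')
        (pow_add I j 2 ▸ Ideal.mul_mem_mul hx (hσ y))
    · rw [map_add, add_sub_add_comm]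
      exact add_mem hx hy

variable {k R : Type*} [CommRing k] [CommRing R] [Algebra k R]

theorem sub_one_pow_apply_mem_pow {I : Ideal R} {σ : R →ₐ[k] R} (hσ : ∀ a, σ a - a ∈ I ^ 2)
    (j : ℕ) (a : R) : ((AlgHom.toEnd σ - 1) ^ j) a ∈ I ^ j := by
  induction j with
  | zero => simp
  | succ j ih =>
    rw [pow_succ' (AlgHom.toEnd σ - 1), Module.End.mul_apply]
    exact map_sub_mem_pow_succ (σ := (σ : R →+* R)) hσ ih

theorem eq_one_of_pow_eq_one_of_sub_mem_sq {I : Ideal R} (hI : ⨅ j, I ^ j = ⊥) {σ : R →ₐ[k] R}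
    {N : ℕ} (hN : IsUnit (N : k)) (hpow : σ ^ N = 1) (hσ : ∀ a, σ a - a ∈ I ^ 2) : σ = 1 := by
  have hN' : IsUnit (N : Module.End k R) := by
    simpa only [map_natCast] using hN.map (algebraMap k (Module.End k R))
  have hpow' : AlgHom.toEnd σ ^ N = 1 := by
    rw [← map_pow, hpow, map_one]
  ext a
  have hmem : σ a - a ∈ ⨅ j, I ^ j := by
    refine (Submodule.mem_iInf _).2 fun j => ?_
    obtain ⟨w, hw⟩ := sub_one_pow_dvd_of_pow_eq_one hN' hpow' j
    have happly : σ a - a = ((AlgHom.toEnd σ - 1) ^ j) (w a) := LinearMap.congr_fun hw a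
    exact happly ▸ sub_one_pow_apply_mem_pow hσ j (w a)
  rw [hI] at hmem
  exact sub_eq_zero.1 hmem

end FiniteOrder

section CotangentAction

open IsLocalRing

variable {k R G : Type*} [Field k] [CommRing R] [IsLocalRing R] [Algebra k R] [Group G]

theorem maximalIdeal_le_comap (τ : G →* (R →ₐ[k] R)) (g : G) :
    maximalIdeal R ≤ (maximalIdeal R).comap (τ g) := fun a ha hunit => ha <| by
  simpa only [← AlgHom.mul_apply, ← map_mul, inv_mul_cancel, map_one, AlgHom.one_apply]
    using hunit.map (τ g⁻¹)

/-- The linear action on the cotangent space `𝔪 / 𝔪 ^ 2` induced by an action `τ` of a group on a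
local algebra. -/
def cotangentAction (τ : G →* (R →ₐ[k] R)) : G →* Module.End k (CotangentSpace R) where
  toFun g := Ideal.mapCotangent _ _ (τ g) (maximalIdeal_le_comap τ g)
  map_one' := by
    ext x
    obtain ⟨x, rfl⟩ := Ideal.toCotangent_surjective _ x
    simp
  map_mul' g h := by
    ext x
    obtain ⟨x, rfl⟩ := Ideal.toCotangent_surjective _ x
    simp

theorem map_sub_mem_sq_of_cotangentAction_eq_one
    (hk : Function.Surjective (algebraMap k (ResidueField R))) {τ : G →* (R →ₐ[k] R)} {g : G}
    (hg : cotangentAction τ g = 1) (a : R) : τ g a - a ∈ maximalIdeal R ^ 2 := by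
  obtain ⟨c, hc⟩ := hk (residue R a)
  have hmem : a - algebraMap k R c ∈ maximalIdeal R := by
    rw [← residue_eq_zero_iff, map_sub, ← hc, sub_eq_zero]
    rfl
  have hfix : τ g (a - algebraMap k R c) - (a - algebraMap k R c) ∈ maximalIdeal R ^ 2 :=
    (Ideal.toCotangent_eq _).1 (LinearMap.congr_fun hg ((maximalIdeal R).toCotangent ⟨_, hmem⟩))
  simpa using hfix

theorem cotangentAction_injective [IsNoetherianRing R] (hG : (Nat.card G : k) ≠ 0)
    (hk : Function.Surjective (algebraMap k (ResidueField R))) {τ : G →* (R →ₐ[k] R)}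
    (hτ : Function.Injective τ) : Function.Injective (cotangentAction τ) := by
  refine (injective_iff_map_eq_one _).2 fun g hg => (map_eq_one_iff τ hτ).1 ?_
  refine eq_one_of_pow_eq_one_of_sub_mem_sq
    (Ideal.iInf_pow_eq_bot_of_isLocalRing (maximalIdeal R) Ideal.IsPrime.ne_top')
    hG.isUnit ?_ (map_sub_mem_sq_of_cotangentAction_eq_one hk hg)
  rw [← map_pow, pow_card_eq_one', map_one]

theorem isScalarTower_residueField_cotangentSpace :
    IsScalarTower k (ResidueField R) (CotangentSpace R) :=
  .of_algebraMap_smul fun c x => by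
    rw [IsScalarTower.algebraMap_apply k R (ResidueField R), IsScalarTower.algebraMap_smul,
      IsScalarTower.algebraMap_smul]

theorem finiteDimensional_cotangentSpace [IsNoetherianRing R]
    (hk : Function.Surjective (algebraMap k (ResidueField R))) :
    FiniteDimensional k (CotangentSpace R) :=
  have := isScalarTower_residueField_cotangentSpace (k := k) (R := R)
  have : Module.Finite k (ResidueField R) := .of_surjective (Algebra.linearMap _ _) hk
  Module.Finite.trans (ResidueField R) _

theorem finrank_cotangentSpace_eq (hk : Function.Bijective (algebraMap k (ResidueField R))) :
    Module.finrank k (CotangentSpace R) = Module.finrank (ResidueField R) (CotangentSpace R) := by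
  have := isScalarTower_residueField_cotangentSpace (k := k) (R := R)
  have hone : Module.finrank k (ResidueField R) = 1 := by
    rw [← (LinearEquiv.ofBijective (Algebra.linearMap k (ResidueField R)) hk).finrank_eq,
      Module.finrank_self]
  rw [← Module.finrank_mul_finrank k (ResidueField R) (CotangentSpace R), hone, one_mul]

theorem exists_injective_generalLinearGroup_of_finrank_le {M : Type*} [AddCommGroup M]
    [Module k M] [FiniteDimensional k M] {f : G →* Module.End k M} (hf : Function.Injective f)
    {n : ℕ} (hn : Module.finrank k M ≤ n) : ∃ F : G →* GL (Fin n) k, Function.Injective F := by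
  let V := M × (Fin (n - Module.finrank k M) → k)
  let extend : Module.End k M →* Module.End k V :=
    { toFun := fun u => u.prodMap LinearMap.id
      map_one' := rfl
      map_mul' := fun _ _ => rfl }
  have hextend : Function.Injective extend := fun u v h =>
    LinearMap.ext fun x => congrArg Prod.fst (LinearMap.congr_fun h (x, 0))
  have hV : Module.finrank k V = n := by simp [V, hn]
  let toMatrix := LinearMap.toMatrixAlgEquiv (Module.finBasisOfFinrankEq k V hV)
  let F : G →* Matrix (Fin n) (Fin n) k :=
    ((toMatrix : Module.End k V →* Matrix (Fin n) (Fin n) k).comp extend).comp f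
  have hF : Function.Injective F := (toMatrix.injective.comp hextend).comp hf
  exact ⟨F.toHomUnits, fun a b h => hF (congrArg Units.val h)⟩

theorem exists_injective_generalLinearGroup_of_localRing [IsNoetherianRing R]
    (hG : (Nat.card G : k) ≠ 0) (hk : Function.Bijective (algebraMap k (ResidueField R)))
    {τ : G →* (R →ₐ[k] R)} (hτ : Function.Injective τ) {n : ℕ}
    (hn : Module.finrank (ResidueField R) (CotangentSpace R) ≤ n) :
    ∃ F : G →* GL (Fin n) k, Function.Injective F :=
  have := finiteDimensional_cotangentSpace (k := k) (R := R) hk.surjective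
  exists_injective_generalLinearGroup_of_finrank_le (cotangentAction_injective hG hk.surjective hτ)
    ((finrank_cotangentSpace_eq hk).trans_le hn)

end CotangentAction

section Stalks

variable {k : Type u} [Field k] {X : Scheme.{u}} {x : X}

/-- The endomorphism of the local ring of `X` at `x` induced by an endomorphism of `X` that fixes
`x`. -/
noncomputable def stalkEnd (f : X ⟶ X) (hf : f x = x) :
    X.presheaf.stalk x ⟶ X.presheaf.stalk x :=
  X.presheaf.stalkSpecializes (specializes_of_eq hf) ≫ f.stalkMap x

theorem specMap_stalkEnd_fromSpecStalk (f : X ⟶ X) (hf : f x = x) :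
    Spec.map (stalkEnd f hf) ≫ X.fromSpecStalk x = X.fromSpecStalk x ≫ f := by
  rw [stalkEnd, Spec.map_comp, Category.assoc, Scheme.SpecMap_stalkSpecializes_fromSpecStalk,
    Scheme.SpecMap_stalkMap_fromSpecStalk]

theorem eq_stalkEnd_of_specMap_fromSpecStalk {f : X ⟶ X} (hf : f x = x)
    {φ : X.presheaf.stalk x ⟶ X.presheaf.stalk x}
    (hφ : Spec.map φ ≫ X.fromSpecStalk x = X.fromSpecStalk x ≫ f) : φ = stalkEnd f hf :=
  Spec.map_injective <| (cancel_mono (X.fromSpecStalk x)).1 <|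
    hφ.trans (specMap_stalkEnd_fromSpecStalk f hf).symm

theorem stalkEnd_id (h : (𝟙 X : X ⟶ X) x = x) : stalkEnd (𝟙 X) h = 𝟙 _ :=
  (eq_stalkEnd_of_specMap_fromSpecStalk h <| by
    rw [Spec.map_id, Category.id_comp, Category.comp_id]).symm

theorem stalkEnd_comp {f g : X ⟶ X} (hf : f x = x) (hg : g x = x) (hfg : (f ≫ g) x = x) :
    stalkEnd (f ≫ g) hfg = stalkEnd g hg ≫ stalkEnd f hf :=
  (eq_stalkEnd_of_specMap_fromSpecStalk hfg <| by
    rw [Spec.map_comp, Category.assoc, specMap_stalkEnd_fromSpecStalk,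
      ← Category.assoc, specMap_stalkEnd_fromSpecStalk, Category.assoc]).symm

theorem isDominant_fromSpecStalk [IrreducibleSpace X] (x : X) : IsDominant (X.fromSpecStalk x) := by
  refine ⟨?_⟩
  rw [DenseRange, Scheme.range_fromSpecStalk, dense_iff_closure_eq, ← Set.univ_subset_iff,
    ← genericPoint_closure]
  exact closure_mono (Set.singleton_subset_iff.2 (genericPoint_specializes x))

theorem eq_of_stalkEnd_eq {S : Scheme.{u}} (π : X ⟶ S) [IsSeparated π] [IsReduced X]
    [IrreducibleSpace X] {f g : X ⟶ X} (hf : f x = x) (hg : g x = x) (hfπ : f ≫ π = π)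
    (hgπ : g ≫ π = π) (h : stalkEnd f hf = stalkEnd g hg) : f = g := by
  have := isDominant_fromSpecStalk x
  refine ext_of_isDominant_of_isSeparated π (hfπ.trans hgπ.symm) (X.fromSpecStalk x) ?_
  rw [← specMap_stalkEnd_fromSpecStalk f hf, ← specMap_stalkEnd_fromSpecStalk g hg, h]

/-- The `k`-algebra structure on the local ring at `x` of a scheme `π : X ⟶ Spec k` over `k`. It
depends on `π`, which cannot be inferred from the local ring, so it is not an instance. -/
noncomputable abbrev stalkAlgebra (π : X ⟶ Spec (.of k)) (x : X) :
    Algebra k (X.presheaf.stalk x) :=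
  (Spec.preimage (X.fromSpecStalk x ≫ π)).hom.toAlgebra

theorem preimage_comp_stalkEnd {π : X ⟶ Spec (.of k)} {f : X ⟶ X} (hf : f x = x)
    (hfπ : f ≫ π = π) :
    Spec.preimage (X.fromSpecStalk x ≫ π) ≫ stalkEnd f hf =
      Spec.preimage (X.fromSpecStalk x ≫ π) := by
  apply Spec.map_injective
  rw [Spec.map_comp, Spec.map_preimage, ← Category.assoc, specMap_stalkEnd_fromSpecStalk,
    Category.assoc, hfπ]

theorem bijective_algebraMap_residueField [IsAlgClosed k] (π : X ⟶ Spec (.of k))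
    [LocallyOfFiniteType π] (hx : IsClosed {x}) :
    letI := stalkAlgebra π x
    Function.Bijective (algebraMap k (IsLocalRing.ResidueField (X.presheaf.stalk x))) := by
  have hinv : Spec.preimage (X.fromSpecStalk x ≫ π) ≫ X.residue x =
      (residueFieldIsoBase π x hx).inv := by
    apply Spec.map_injective
    rw [SpecMap_residueFieldIsoBase_inv, Spec.map_comp, Spec.map_preimage, ← Category.assoc]
    rfl
  have hbij := (ConcreteCategory.isIso_iff_bijective (residueFieldIsoBase π x hx).inv).1
    inferInstance
  rwa [← hinv] at hbij

noncomputable instance VarietyAut.instMulAction (π : X ⟶ Spec (.of k)) :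
    MulAction (VarietyAut π) X where
  smul := VarietyAut.act
  one_smul _ := rfl
  mul_smul _ _ _ := rfl

/-- The action of the stabilizer of `x` on the local ring of `X` at `x`. Since pulling back
functions is contravariant, `g` acts through `g⁻¹`. -/
noncomputable def stalkAction (π : X ⟶ Spec (.of k)) (x : X) :
    letI := stalkAlgebra π x
    MulAction.stabilizer (VarietyAut π) x →* (X.presheaf.stalk x →ₐ[k] X.presheaf.stalk x) :=
  letI := stalkAlgebra π x
  { toFun g :=
      { (stalkEnd g.1⁻¹.hom.left (g⁻¹).2).hom with
        commutes' c := ConcreteCategory.congr_hom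
          (preimage_comp_stalkEnd (g⁻¹).2 (Over.w g.1⁻¹.hom)) c }
    map_one' := AlgHom.ext fun a => ConcreteCategory.congr_hom (stalkEnd_id rfl) a
    map_mul' g h := AlgHom.ext fun a => ConcreteCategory.congr_hom
      (stalkEnd_comp (g⁻¹).2 (h⁻¹).2 ((g * h)⁻¹).2) a }

theorem stalkAction_injective (π : X ⟶ Spec (.of k)) [IsSeparated π] [IsReduced X]
    [IrreducibleSpace X] (x : X) : Function.Injective (stalkAction π x) := by
  intro g h hgh
  have hstalk : stalkEnd g.1⁻¹.hom.left (g⁻¹).2 = stalkEnd h.1⁻¹.hom.left (h⁻¹).2 := by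
    ext a
    exact DFunLike.congr_fun hgh a
  have hinv : g.1⁻¹.hom.left = h.1⁻¹.hom.left :=
    eq_of_stalkEnd_eq π _ _ (Over.w g.1⁻¹.hom) (Over.w h.1⁻¹.hom) hstalk
  exact Subtype.ext (inv_injective (Iso.ext (Over.OverMorphism.ext hinv)))

theorem tangentDim_eq_finrank_cotangentSpace (x : X) :
    tangentDim X x = Module.finrank (IsLocalRing.ResidueField (X.presheaf.stalk x))
      (IsLocalRing.CotangentSpace (X.presheaf.stalk x)) :=
  Subspace.dual_finrank_eq

theorem exists_injective_generalLinearGroup_of_le_stabilizer [IsAlgClosed k]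
    {π : X ⟶ Spec (.of k)} (hX : IsAlgebraicVariety π) [IrreducibleSpace X] (hx : IsClosed {x})
    {G : Subgroup (VarietyAut π)} (hcard : (Nat.card G : k) ≠ 0)
    (hG : G ≤ MulAction.stabilizer (VarietyAut π) x)
    {n : ℕ} (hn : tangentDim X x ≤ n) : ∃ F : G →* GL (Fin n) k, Function.Injective F := by
  have := hX.isReduced
  have := hX.isSeparated
  have := hX.locallyOfFiniteType
  have := LocallyOfFiniteType.isLocallyNoetherian π
  let _ := stalkAlgebra π x
  exact exists_injective_generalLinearGroup_of_localRing hcard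
    (bijective_algebraMap_residueField π hx)
    (τ := (stalkAction π x).comp (Subgroup.inclusion hG))
    ((stalkAction_injective π x).comp (Subgroup.inclusion_injective hG))
    (tangentDim_eq_finrank_cotangentSpace x ▸ hn)

end Stalks

section EmbeddingDimension

theorem ker_eq_span_sub_algebraMap {k A : Type*} [CommRing k] [CommRing A] [Algebra k A]
    (χ : A →ₐ[k] k) {s : Set A} (hs : Algebra.adjoin k s = ⊤) :
    RingHom.ker χ = Ideal.span ((fun a => a - algebraMap k A (χ a)) '' s) := by
  set J := Ideal.span ((fun a => a - algebraMap k A (χ a)) '' s)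
  have hmk : Ideal.Quotient.mkₐ k J = (Algebra.ofId k (A ⧸ J)).comp χ :=
    AlgHom.ext_of_adjoin_eq_top hs fun a ha =>
      Ideal.Quotient.eq.2 (Ideal.subset_span ⟨a, ha, rfl⟩)
  refine le_antisymm (fun a ha => ?_) (Ideal.span_le.2 ?_)
  · rw [← Ideal.Quotient.eq_zero_iff_mem]
    simpa [(RingHom.mem_ker).1 ha] using DFunLike.congr_fun hmk a
  · rintro _ ⟨a, -, rfl⟩
    simp

theorem spanFinrank_maximalIdeal_le_card {k A R : Type*} [Field k] [CommRing A] [CommRing R]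
    [IsLocalRing R] [Algebra k A] [Algebra A R] [Algebra k R] [IsScalarTower k A R] (p : Ideal A)
    [p.IsPrime] [IsLocalization.AtPrime R p] {s : Finset A}
    (hs : Algebra.adjoin k (s : Set A) = ⊤)
    (hk : Function.Bijective (algebraMap k (IsLocalRing.ResidueField R))) :
    (IsLocalRing.maximalIdeal R).spanFinrank ≤ s.card := by
  let κ := AlgEquiv.ofBijective (Algebra.ofId k (IsLocalRing.ResidueField R)) hk
  let χ : A →ₐ[k] k := κ.symm.toAlgHom.comp
    ((IsScalarTower.toAlgHom k R _).comp (IsScalarTower.toAlgHom k A R))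
  have hp : RingHom.ker χ = p := by
    ext a
    rw [RingHom.mem_ker, ← IsLocalization.AtPrime.under_maximalIdeal R p, Ideal.mem_comap,
      ← IsLocalRing.residue_eq_zero_iff]
    exact map_eq_zero_iff κ.symm κ.symm.injective
  have hfin := s.finite_toSet.image fun a => a - algebraMap k A (χ a)
  let J := Ideal.span ((fun a => a - algebraMap k A (χ a)) '' (s : Set A))
  have hJ : p = J := hp.symm.trans (ker_eq_span_sub_algebraMap χ hs)
  rw [← IsLocalization.AtPrime.map_eq_maximalIdeal p R, hJ]
  calc
    (Ideal.map (algebraMap A R) J).spanFinrank ≤ J.spanFinrank :=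
      Ideal.spanFinrank_map_le_of_fg _ (Submodule.fg_span hfin)
    _ ≤ _ := Submodule.spanFinrank_span_le_ncard_of_finite hfin
    _ ≤ (s : Set A).ncard := Set.ncard_image_le s.finite_toSet
    _ = s.card := Set.ncard_coe_finset s

end EmbeddingDimension

section TangentDimension

variable {k : Type u} [Field k] {X : Scheme.{u}} {U : X.Opens}

/-- The `k`-algebra structure on the sections over an affine open subset of a scheme
`π : X ⟶ Spec k` over `k`. Like `stalkAlgebra` it depends on `π` and is not an instance. -/
noncomputable abbrev sectionsAlgebra (π : X ⟶ Spec (.of k)) (hU : IsAffineOpen U) :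
    Algebra k Γ(X, U) :=
  (Spec.preimage (hU.fromSpec ≫ π)).hom.toAlgebra

theorem finiteType_sections (π : X ⟶ Spec (.of k)) [LocallyOfFiniteType π]
    (hU : IsAffineOpen U) :
    letI := sectionsAlgebra π hU
    Algebra.FiniteType k Γ(X, U) := by
  have hSpec : LocallyOfFiniteType (Spec.map (Spec.preimage (hU.fromSpec ≫ π))) := by
    rw [Spec.map_preimage]
    infer_instance
  exact (HasRingHomProperty.Spec_iff (P := @LocallyOfFiniteType)).1 hSpec

theorem isScalarTower_sections_stalk (π : X ⟶ Spec (.of k)) (hU : IsAffineOpen U) (x : U) :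
    letI := sectionsAlgebra π hU
    letI := stalkAlgebra π x.1
    letI := X.presheaf.algebra_section_stalk x
    IsScalarTower k Γ(X, U) (X.presheaf.stalk x.1) := by
  let _ := sectionsAlgebra π hU
  let _ := stalkAlgebra π x.1
  let _ := X.presheaf.algebra_section_stalk x
  have hgerm : Spec.preimage (X.fromSpecStalk x.1 ≫ π) =
      Spec.preimage (hU.fromSpec ≫ π) ≫ X.presheaf.germ U x.1 x.2 := by
    apply Spec.map_injective
    rw [Spec.map_preimage, Spec.map_comp, Spec.map_preimage, ← Category.assoc,
      ← hU.fromSpecStalk_eq_fromSpecStalk x.2]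
    rfl
  exact .of_algebraMap_eq fun c => ConcreteCategory.congr_hom hgerm c

theorem tangentDim_eq_spanFinrank [IsLocallyNoetherian X] (x : X) :
    tangentDim X x = (IsLocalRing.maximalIdeal (X.presheaf.stalk x)).spanFinrank :=
  (tangentDim_eq_finrank_cotangentSpace x).trans
    (IsLocalRing.spanFinrank_maximalIdeal_eq_finrank_cotangentSpace _).symm

variable [IsAlgClosed k]

theorem bddAbove_tangentDim_of_isAffineOpen (π : X ⟶ Spec (.of k)) [LocallyOfFiniteType π]
    (hU : IsAffineOpen U) : BddAbove (tangentDim X '' (U ∩ closedPoints X)) := by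
  have := LocallyOfFiniteType.isLocallyNoetherian π
  let _ := sectionsAlgebra π hU
  obtain ⟨s, hs⟩ := (finiteType_sections π hU).out
  refine ⟨s.card, ?_⟩
  rintro _ ⟨x, ⟨hxU, hx⟩, rfl⟩
  let _ := stalkAlgebra π x
  let _ := X.presheaf.algebra_section_stalk ⟨x, hxU⟩
  have := isScalarTower_sections_stalk π hU ⟨x, hxU⟩
  have := hU.isLocalization_stalk ⟨x, hxU⟩
  rw [tangentDim_eq_spanFinrank]
  exact spanFinrank_maximalIdeal_le_card (hU.primeIdealOf ⟨x, hxU⟩).asIdeal hs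
    (bijective_algebraMap_residueField π hx)

theorem bddAbove_tangentDim (π : X ⟶ Spec (.of k)) [LocallyOfFiniteType π] [CompactSpace X] :
    BddAbove (tangentDim X '' closedPoints X) := by
  rw [← Set.univ_inter (closedPoints X)]
  refine isCompact_univ.induction_on (p := fun S => BddAbove (tangentDim X '' (S ∩ closedPoints X)))
    (by simp) (fun S T hST hT => hT.mono (by gcongr)) (fun S T hS hT => ?_) fun x _ => ?_
  · rw [Set.union_inter_distrib_right, Set.image_union]
    exact hS.union hT
  · obtain ⟨U, hU, hxU, -⟩ := exists_isAffineOpen_mem_and_subset (U := ⊤) (Set.mem_univ x)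
    exact ⟨U, mem_nhdsWithin_of_mem_nhds (U.isOpen.mem_nhds hxU),
      bddAbove_tangentDim_of_isAffineOpen π hU⟩

theorem isGreatest_maxTangentDim (π : X ⟶ Spec (.of k)) [LocallyOfFiniteType π] [CompactSpace X]
    [Nonempty X] :
    IsGreatest (Set.range fun x : VarietyPoint X => tangentDim X x.1) (maxTangentDim X) := by
  have hbdd : BddAbove (Set.range fun x : VarietyPoint X => tangentDim X x.1) := by
    simpa only [Set.image_eq_range] using bddAbove_tangentDim π
  obtain ⟨x, -, hx⟩ := isClosed_univ.exists_closed_singleton (Set.univ_nonempty (α := X))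
  exact ⟨Nat.sSup_mem ⟨_, ⟨x, hx⟩, rfl⟩ hbdd, fun _ hn => le_csSup hbdd hn⟩

end TangentDimension

theorem mainTheorem5 {k : Type u} [Field k] [IsAlgClosed k] [CharZero k]
    {X : Scheme.{u}} (π : X ⟶ Spec (.of k)) (hX : IsAlgebraicVariety π)
    (hirr : IrreducibleSpace X) :
    IsGreatest (Set.range fun x : VarietyPoint X => tangentDim X x.1) (maxTangentDim X) ∧
    (∀ G : Subgroup (VarietyAut π), Finite G → HasFixedPoint G →
      ∃ A : Subgroup G, A.Normal ∧ IsMulCommutative A ∧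
        A.index ≤ jordanConstant (GL (Fin (maxTangentDim X)) k)) ∧
    ((∀ G : Subgroup (VarietyAut π), Finite G → HasFixedPoint G) →
      IsJordanGroup (VarietyAut π) ∧
        jordanConstant (VarietyAut π) ≤ jordanConstant (GL (Fin (maxTangentDim X)) k)) := by
  have := hX.locallyOfFiniteType
  have := hX.quasiCompact
  have : CompactSpace X := QuasiCompact.compactSpace_of_compactSpace π
  have hmax := isGreatest_maxTangentDim π
  have hGL := isJordanGroup_generalLinearGroup (Fin (maxTangentDim X)) k
  have hfix (G : Subgroup (VarietyAut π)) (_ : Finite G) (hG : HasFixedPoint G) :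
      HasNormalAbelianSubgroupOfIndexLE G (jordanConstant (GL (Fin (maxTangentDim X)) k)) := by
    obtain ⟨x, hx⟩ := hG
    obtain ⟨F, hF⟩ :=
      exists_injective_generalLinearGroup_of_le_stabilizer hX x.2
        (Nat.cast_ne_zero.2 Nat.card_pos.ne') hx (hmax.2 ⟨x, rfl⟩)
    exact hGL.jordanBound_jordanConstant.hasNormalAbelianSubgroup_of_injective hF
  refine ⟨hmax, hfix, fun h => ?_⟩
  have hAut : JordanBound (VarietyAut π) (jordanConstant (GL (Fin (maxTangentDim X)) k)) :=
    fun G hG => hfix G hG (h G hG)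
  exact ⟨⟨_, hGL.jordanConstant_pos, hAut⟩, hAut.jordanConstant_le hGL.jordanConstant_pos⟩
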